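/- Conventions. Let $G$ be a countable group. A dynamical system $(X,G)$ is a compact metrizable space $X$ with an action of $G$ by homeomorphisms; $\rho$ denotes a metric on $X$ compatible with the topology, and none of the notions below depends on its choice. * $(X,G)$ is *expansive* if there is $c>0$ such that for all distinct $x,y\in X$ there is $g\in G$ with $\rho(gx,gy)>c$. * $(X,G)$ has the *weak specification property* if for every $\varepsilon>0$ there is a finite symmetric set $F\subset G$ containing $1_G$ such that for all finite $A_1,\dots,A_n\subset G$ with $FA_i\cap FA_j=\varnothing$ whenever $i\neq j$, and all $x_1,\dots,x_n\in X$, there is $z\in X$ with $\rho(sx_i,sz)\le\varepsilon$ for all $i$ and all $s\in A_i$. * $(X,G)$ has the *strong topological Markov property* if for every $\varepsilon>0$ there are $\delta>0$ and a finite set $F\subset G$ containing $1_G$ such that for every finite $A\subset G$ and all $x,y\in X$ with $\rho(sx,sy)\le\delta$ for all $s\in FA\setminus A$, there is $z\in X$ with $\rho(sz,sx)\le\varepsilon$ for all $s\in FA$ and $\rho(sz,sy)\le\varepsilon$ for all $s\in G\setminus A$. * A *sofic approximation* of $G$ is a sequence $\Sigma=(d_j,\sigma_j)_{j\in\mathbb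 N}$ of positive integers $d_j\to\infty$ and maps $\sigma_j\colon G\to\mathrm{Sym}(d_j)$, written $s\mapsto\sigma_{j,s}$, such that $\eta_{d_j}(\sigma_{j,s}\sigma_{j,t},\sigma_{j,st})\to0$ for all $s,t\in G$ and $\eta_{d_j}(\sigma_{j,s},\sigma_{j,t})\to1$ for all distinct $s,t\in G$, where $\eta_d(\sigma,\tau)=\frac1d|\{a\in[d]:\sigma(a)\ne\tau(a)\}|$ and $[d]=\{1,\dots,d\}$. The countable group $G$ is *sofic* if it has a sofic approximation. * For a nonempty finite $F\subset G$, $\delta>0$ and $\sigma\colon G\to\mathrm{Sym}(d)$, let $\mathrm{Map}(X,\rho,F,\delta,\sigma)$ be the set of all $\varphi\colon[d]\to X$ with $\big(\frac1d\sum_{a\in[d]}\rho(\varphi(\sigma_s a),s\varphi(a))^2\big)^{1/2}<\delta$ for all $s\in F$. Let $\rho_\infty(\varphi,\psi)=\max_{a\in[d]}\rho(\varphi(a),\psi(a))$, and let $N_\varepsilon(\cdot,\rho_\infty)$ be the maximal cardinality of a subset whose distinct elements are at $\rho_\infty$-distance at least $\varepsilon$. The *sofic topological entropy* is $$h_\Sigma(X,G)=\sup_{\varepsilon>0}\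 \inf_{\substack{F\subset G\\ \text{finite, nonempty}}}\ \inf_{\delta>0}\ \limsup_{j\to\infty}\frac1{d_j}\log N_\varepsilon(\mathrm{Map}(X,\rho,F,\delta,\sigma_j),\rho_\infty)\in[-\infty,\infty],$$ with $\log0=-\infty$. **Proposition.** Let $G$ be a countable sofic group and let $(X,G)$ be an expansive dynamical system with the weak specification property and the strong topological Markov property. Let $\Sigma$ be a sofic approximation of $G$ with $h_\Sigma(X,G)\ge0$. Then for every closed $G$-invariant subset $Y\subsetneq X$ (with the restricted action, and with the empty set allowed), $h_\Sigma(Y,G)<h_\Sigma(X,G)$. -/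

import Mathlib

open scoped Pointwise
open Filter Topology

namespace SoficDynamics

/-- The normalized Hamming distance `η_d` on `Sym(d)`. -/
noncomputable def normHamming {d : ℕ} (σ τ : Equiv.Perm (Fin d)) : ℝ :=
  ((Finset.univ.filter fun a : Fin d => σ a ≠ τ a).card : ℝ) / d

/-- A sofic approximation `Σ = (d_j, σ_j)_{j ∈ ℕ}` of the group `G`; the maps
`σ_j : G → Sym(d_j)` are arbitrary maps, asymptotically multiplicative and asymptotically free.
A countable group is sofic exactly when it has one. -/
structure SoficApproximation (G : Type*) [Group G] where
  d : ℕ → ℕ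
  d_pos : ∀ j, 0 < d j
  σ : ∀ j, G → Equiv.Perm (Fin (d j))
  tendsto_d : Tendsto d atTop atTop
  tendsto_mul : ∀ s t : G,
    Tendsto (fun j => normHamming (σ j s * σ j t) (σ j (s * t))) atTop (𝓝 0)
  tendsto_free : ∀ s t : G, s ≠ t →
    Tendsto (fun j => normHamming (σ j s) (σ j t)) atTop (𝓝 1)

section Properties

variable (G X : Type*) [Group G] [MetricSpace X] [MulAction G X]

/-- Expansivity: any two distinct points are moved more than `c` apart by some group element. -/
def IsExpansive : Prop :=
  ∃ c : ℝ, 0 < c ∧ ∀ x y : X, x ≠ y → ∃ g : G, c < dist (g • x) (g • y)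

/-- The weak specification property. -/
def WeakSpecification : Prop :=
  ∀ ε : ℝ, 0 < ε → ∃ F : Finset G, (1 : G) ∈ F ∧ (∀ g ∈ F, g⁻¹ ∈ F) ∧
    ∀ (n : ℕ) (A : Fin n → Finset G) (x : Fin n → X),
      (∀ i j, i ≠ j →
        Disjoint ((F : Set G) * (A i : Set G)) ((F : Set G) * (A j : Set G))) →
      ∃ z : X, ∀ i, ∀ s ∈ A i, dist (s • x i) (s • z) ≤ ε

/-- The strong topological Markov property. -/
def StrongTopologicalMarkov : Prop :=
  ∀ ε : ℝ, 0 < ε → ∃ δ : ℝ, 0 < δ ∧ ∃ F : Finset G, (1 : G) ∈ F ∧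
    ∀ (A : Finset G) (x y : X),
      (∀ s ∈ ((F : Set G) * (A : Set G)) \ (A : Set G), dist (s • x) (s • y) ≤ δ) →
      ∃ z : X, (∀ s ∈ (F : Set G) * (A : Set G), dist (s • z) (s • x) ≤ ε) ∧
        ∀ s : G, s ∉ A → dist (s • z) (s • y) ≤ ε

end Properties

section Entropy

variable {G X : Type*} [Group G] [MetricSpace X] [MulAction G X]

/-- The normalized `ℓ²`-distance `ρ₂` on `X^d`. -/
noncomputable def rho2 {d : ℕ} (φ ψ : Fin d → X) : ℝ :=
  Real.sqrt ((1 / (d : ℝ)) * ∑ a, dist (φ a) (ψ a) ^ 2)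

/-- `Map(X, ρ, F, δ, σ)`: the maps `φ : [d] → X` with `ρ₂(φ ∘ σ_s, s φ) < δ` for all `s ∈ F`. -/
def soficMaps (X : Type*) [MetricSpace X] [MulAction G X] (F : Finset G) (δ : ℝ) {d : ℕ}
    (σ : G → Equiv.Perm (Fin d)) : Set (Fin d → X) :=
  {φ | ∀ s ∈ F, rho2 (fun a => φ (σ s a)) (fun a => s • φ a) < δ}

/-- `N_ε(S, dist)`: the maximal cardinality of a subset `Z ⊆ S` whose distinct points are at
distance at least `ε`. -/
noncomputable def sepNumber {M : Type*} [MetricSpace M] (ε : ℝ) (S : Set M) : ℕ∞ :=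
  ⨆ (Z : Set M) (_ : Z ⊆ S ∧ Z.Pairwise fun φ ψ => ε ≤ dist φ ψ), Z.encard

/-- The sofic topological entropy `h_Σ(X, G)`, with values in `[-∞, ∞]`. The distance on
`Fin d → X` used by `sepNumber` is the maximum distance `ρ_∞`; moreover `log 0 = -∞`. -/
noncomputable def soficEntropy (S : SoficApproximation G) (X : Type*) [MetricSpace X]
    [MulAction G X] : EReal :=
  ⨆ (ε : ℝ) (_ : 0 < ε), ⨅ (F : Finset G) (_ : F.Nonempty), ⨅ (δ : ℝ) (_ : 0 < δ),
    limsup (fun j => ((1 / (S.d j : ℝ) : ℝ) : EReal) *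
      ENNReal.log ((sepNumber ε (soficMaps X F δ (S.σ j)) : ℕ∞) : ENNReal)) atTop

end Entropy

end SoficDynamics

/-! Fix `x₀` outside `Y`, at distance at least `r` from it. The gluing properties allow a microstate
of `Y` to be altered so as to come near `x₀` on an arbitrary subset `P` of a separated set of good
sites, whose density is bounded below. The results are microstates of `X`, and their exponential
surplus is the entropy gap (`exists_scaleEntropy_gap`).

Overcounting is controlled because the altered microstate reveals `P` (at the other separated sites
it stays near `Y`) and reveals the original one except at `#A` sites per point of `P`. Hence a
separated family has at most `K ^ #P` candidates for the original, and weighting the pair by `K⁻¹ ^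
#P` yields a gain `(1 + K⁻¹) ^ m` with `m` linear in `d` (`card_mul_pow_le_card`).

The alteration (`exists_modification`) is defined site by site: at a good `b`, the set `P` is pulled
back to `G` along `s ↦ σ s b`, and the point `φ b` is altered there by `exists_replace` and
`exists_glue`. The result is equivariant only up to a fixed scale, but on any prescribed finite
window of `G`; expansivity turns this into arbitrarily small error. So the gap does not depend on
the tolerance demanded of the microstates of `X`. Expansivity also makes the entropy computable at
one scale, hence not `⊤`. -/

namespace SoficDynamics

/-! ### Gluing orbits in `X`. -/

section Gluing

variable {G X : Type*} [Group G] [MetricSpace X] [MulAction G X]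

/-- Every point can be replaced near the identity by a given point `x₀` without changing its
orbit outside a fixed finite set. -/
theorem exists_replace (hspec : WeakSpecification G X) (hmarkov : StrongTopologicalMarkov G X)
    (x₀ : X) {ε : ℝ} (hε : 0 < ε) :
    ∃ A : Finset G, (1 : G) ∈ A ∧ ∀ y : X, ∃ z : X, dist z x₀ ≤ ε ∧
      ∀ g : G, g ∉ A → dist (g • z) (g • y) ≤ ε := by
  classical
  obtain ⟨δ, hδ, F, hF1, hF⟩ := hmarkov (ε / 2) (half_pos hε)
  obtain ⟨E, hE1, hEinv, hE⟩ := hspec (min (ε / 2) δ) (lt_min (half_pos hε) hδ)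
  -- Specification can prescribe the identity and the shell of `E * E` independently: a shell point
  -- `g` with `e' * g = e` would lie in `E⁻¹ * E = E * E`.
  refine ⟨E * E, by simpa using Finset.mul_mem_mul hE1 hE1, fun y => ?_⟩
  have hdisj : Disjoint ((E : Set G) * (({1} : Finset G) : Set G))
      ((E : Set G) * (((F * (E * E)) \ (E * E) : Finset G) : Set G)) := by
    rw [Set.disjoint_left]
    rintro _ ⟨e, he, o, ho, rfl⟩ ⟨e', he', g, hg, h⟩
    simp only [Finset.coe_singleton, Set.mem_singleton_iff] at ho
    subst ho
    simp only [mul_one] at h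
    rw [Finset.mem_coe, Finset.mem_sdiff] at hg
    refine hg.2 ?_
    have : g = e'⁻¹ * e := by rw [← h]; group
    rw [this]
    exact Finset.mul_mem_mul (hEinv _ he') he
  obtain ⟨w, hw⟩ := hE 2 ![{1}, (F * (E * E)) \ (E * E)] ![x₀, y] (by
    intro i j hij
    fin_cases i <;> fin_cases j
    · exact absurd rfl hij
    · exact hdisj
    · exact hdisj.symm
    · exact absurd rfl hij)
  have hw0 : dist x₀ w ≤ ε / 2 := by
    have := hw 0 1 (by simp)
    simp only [one_smul] at this
    exact this.trans (min_le_left _ _)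
  have hw1 : ∀ s ∈ (F * (E * E)) \ (E * E), dist (s • y) (s • w) ≤ δ := fun s hs =>
    (hw 1 s hs).trans (min_le_right _ _)
  -- `w` is near `x₀` at the identity and follows `y` on the shell, so the Markov property extends
  -- it by `y` outside `E * E`.
  obtain ⟨z, hz, hz'⟩ := hF (E * E) w y (by
    intro s hs
    rw [← Finset.coe_mul, ← Finset.coe_sdiff] at hs
    rw [dist_comm]
    exact hw1 s hs)
  refine ⟨z, ?_, fun g hg => (hz' g hg).trans (half_le_self hε.le)⟩
  have h1 : dist z w ≤ ε / 2 := by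
    have := hz 1 ⟨1, hF1, 1,
      Finset.mem_coe.2 (by simpa using Finset.mul_mem_mul hE1 hE1), by simp⟩
    simpa using this
  linarith [dist_triangle z w x₀, dist_comm w x₀]

/-- Modifications of a point `y` at finitely many sufficiently separated sites can be carried out
simultaneously. -/
theorem exists_glue [DecidableEq G] (hspec : WeakSpecification G X)
    (hmarkov : StrongTopologicalMarkov G X) {ε : ℝ} (hε : 0 < ε) :
    ∃ δ : ℝ, 0 < δ ∧ ∃ F : Finset G, ∀ A : Finset G, ∃ D : Finset G,
      ∀ (S : Finset G) (y : X) (z : G → X),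
        (∀ s ∈ S, ∀ t ∈ S, s ≠ t → t * s⁻¹ ∉ D) →
        (∀ s ∈ S, ∀ g ∈ F * A, g ∉ A → dist (g • z s) (g • s • y) ≤ δ) →
        ∃ q : X, (∀ s ∈ S, ∀ g ∈ A, dist ((g * s) • q) (g • z s) ≤ ε) ∧
          ∀ g : G, (∀ s ∈ S, g * s⁻¹ ∉ A) → dist (g • q) (g • y) ≤ ε := by
  obtain ⟨δ, hδ, F, hF1, hF⟩ := hmarkov (ε / 2) (half_pos hε)
  obtain ⟨E, -, -, hE⟩ := hspec (min (ε / 2) (δ / 2)) (lt_min (half_pos hε) (half_pos hδ))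
  -- `t * s⁻¹ ∉ D` says precisely that the translates of `E * (F * A)` by `s` and `t` are disjoint.
  -- The two halves of `δ` pay for `w` against `z s` and for `z s` against `s • y`.
  refine ⟨δ / 2, half_pos hδ, F, fun A => ⟨(E * (F * A))⁻¹ * (E * (F * A)), ?_⟩⟩
  intro S y z hS hz
  obtain ⟨w, hw⟩ := hE S.card (fun i => (F * A) * {(S.equivFin.symm i : G)})
    (fun i => (S.equivFin.symm i : G)⁻¹ • z (S.equivFin.symm i)) (by
      intro i j hij
      rw [Set.disjoint_left]
      rintro _ ⟨e, he, g, hg, rfl⟩ ⟨e', he', g', hg', h⟩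
      rw [Finset.mem_coe] at he he' hg hg'
      obtain ⟨b, hb, s, hs, rfl⟩ := Finset.mem_mul.1 hg
      obtain ⟨b', hb', s', hs', rfl⟩ := Finset.mem_mul.1 hg'
      rw [Finset.mem_singleton] at hs hs'
      have hne : s ≠ s' := by
        rw [hs, hs']
        exact fun h => hij (S.equivFin.symm.injective (Subtype.ext h))
      refine hS s (hs ▸ (S.equivFin.symm i).2) s' (hs' ▸ (S.equivFin.symm j).2) hne ?_
      have : s' * s⁻¹ = (e' * b')⁻¹ * (e * b) := by
        have h' : e' * (b' * s') = e * (b * s) := h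
        rw [eq_inv_mul_iff_mul_eq, ← mul_assoc, mul_inv_eq_iff_eq_mul, mul_assoc e', mul_assoc e]
        exact h'
      rw [this]
      exact Finset.mul_mem_mul (Finset.inv_mem_inv (Finset.mul_mem_mul he' hb'))
        (Finset.mul_mem_mul he hb))
  have hw' : ∀ s ∈ S, ∀ g ∈ F * A,
      dist ((g * s) • w) (g • z s) ≤ min (ε / 2) (δ / 2) := by
    intro s hs g hg
    have := hw (S.equivFin ⟨s, hs⟩) (g * s) (by
      simp only [Equiv.symm_apply_apply]
      exact Finset.mul_mem_mul hg (Finset.mem_singleton_self s))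
    simp only [Equiv.symm_apply_apply] at this
    rw [dist_comm, mul_smul g s (s⁻¹ • z s), smul_inv_smul] at this
    exact this
  -- A single application handles all sites: a shell point `f * a * s` of `A * S` has `f * a ∉ A`,
  -- which is where `z s` is known to follow `s • y`.
  obtain ⟨q, hq, hq'⟩ := hF (A * S) w y (by
    rintro _ ⟨⟨f, hf, _, hg, rfl⟩, hn⟩
    rw [Finset.mem_coe] at hf hg hn
    obtain ⟨a, ha, s, hs, rfl⟩ := Finset.mem_mul.1 hg
    have hfa : f * a ∈ F * A := Finset.mul_mem_mul hf ha
    have hfan : f * a ∉ A := fun h => hn (by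
      simpa only [mul_assoc] using Finset.mul_mem_mul h hs)
    have h1 := (hw' s hs _ hfa).trans (min_le_right _ _)
    have h2 := hz s hs _ hfa hfan
    rw [← mul_smul (f * a) s y] at h2
    simp only [← mul_assoc]
    linarith [dist_triangle ((f * a * s) • w) ((f * a) • z s) ((f * a * s) • y)])
  refine ⟨q, fun s hs g hg => ?_, fun g hg => ?_⟩
  · have h1 := hq (g * s) ⟨1, hF1, g * s, Finset.mem_coe.2 (Finset.mul_mem_mul hg hs), one_mul _⟩
    have h2 := (hw' s hs g (by simpa using Finset.mul_mem_mul hF1 hg)).trans (min_le_left _ _)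
    linarith [dist_triangle ((g * s) • q) ((g * s) • w) (g • z s)]
  · refine (hq' g fun h => ?_).trans (half_le_self hε.le)
    obtain ⟨a, ha, s, hs, rfl⟩ := Finset.mem_mul.1 h
    exact hg s hs (by simpa using ha)

end Gluing

/-! ### Double counting. -/

section Counting

variable {Φ Ψ β : Type*}

theorem card_le_pow_of_label {K : ℕ} (Z : Finset Φ) (N : Finset β) (l : Φ → β → Fin K)
    (h : ∀ φ ∈ Z, ∀ ψ ∈ Z, (∀ b ∈ N, l φ b = l ψ b) → φ = ψ) : Z.card ≤ K ^ N.card := by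
  classical
  have := Finset.card_le_card_of_injOn (s := Z) (t := (Finset.univ : Finset (N → Fin K)))
    (fun φ b => l φ b) (fun _ _ => Finset.mem_univ _)
    (fun φ hφ ψ hψ e => h φ hφ ψ hψ fun b hb => congrFun e ⟨b, hb⟩)
  simpa using this

/-- Weighted double counting: if from each `φ ∈ Z` and each `P ⊆ V φ` one produces an element of
`T` that determines `P`, and `φ` up to `K ^ #P` possibilities, then `T` is much larger
than `Z`. -/
theorem card_mul_pow_le_card [DecidableEq Φ] [DecidableEq Ψ] [DecidableEq β]
    (Z : Finset Φ) (T : Finset Ψ) (V : Φ → Finset β) (f : Φ → Finset β → Ψ) {K : ℝ} (hK : 0 < K)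
    {m : ℕ} (hV : ∀ φ ∈ Z, m ≤ (V φ).card)
    (hT : ∀ φ ∈ Z, ∀ P ⊆ V φ, f φ P ∈ T)
    (hinj : ∀ φ ∈ Z, ∀ ψ ∈ Z, ∀ P ⊆ V φ, ∀ Q ⊆ V ψ, f φ P = f ψ Q → P = Q)
    (hfib : ∀ P y, ((Z.filter fun φ => P ⊆ V φ ∧ f φ P = y).card : ℝ) ≤ K ^ P.card) :
    (Z.card : ℝ) * (1 + K⁻¹) ^ m ≤ T.card := by
  -- Give a pair `(φ, P)` the weight `K⁻¹ ^ #P`. Over the subsets of `V φ` the weights sum to `(1 +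
  -- K⁻¹) ^ #(V φ)`; over a fibre of `f`, where `P` is constant, to at most 1.
  set Θ : Finset (Sigma fun _ : Φ => Finset β) := Z.sigma fun φ => (V φ).powerset with hΘ
  have hmem : ∀ x, x ∈ Θ ↔ x.1 ∈ Z ∧ x.2 ⊆ V x.1 := fun x => by
    rw [hΘ, Finset.mem_sigma, Finset.mem_powerset]
  have h1 : (Z.card : ℝ) * (1 + K⁻¹) ^ m ≤ ∑ x ∈ Θ, K⁻¹ ^ x.2.card := by
    rw [hΘ, Finset.sum_sigma, ← nsmul_eq_mul]
    refine Finset.card_nsmul_le_sum _ _ _ fun φ hφ => ?_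
    have := Finset.sum_pow_mul_eq_add_pow K⁻¹ 1 (V φ)
    simp only [one_pow, mul_one] at this
    simp only [this]
    rw [add_comm]
    exact pow_le_pow_right₀ (by have := inv_pos.2 hK; linarith) (hV φ hφ)
  refine h1.trans ?_
  rw [← Finset.sum_fiberwise_of_maps_to (t := T) (g := fun x => f x.1 x.2)
    (fun x hx => hT _ ((hmem x).1 hx).1 _ ((hmem x).1 hx).2), Finset.card_eq_sum_ones,
    Nat.cast_sum]
  refine Finset.sum_le_sum fun y _ => ?_
  rcases (Θ.filter fun x => f x.1 x.2 = y).eq_empty_or_nonempty with h | ⟨x₀, hx₀⟩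
  · rw [h]; simp
  rw [Finset.mem_filter, hmem] at hx₀
  have hP : ∀ x ∈ Θ.filter fun x => f x.1 x.2 = y, x.2 = x₀.2 := fun x hx => by
    rw [Finset.mem_filter, hmem] at hx
    exact hinj _ hx.1.1 _ hx₀.1.1 _ hx.1.2 _ hx₀.1.2 (hx.2.trans hx₀.2.symm)
  have hcard : (Θ.filter fun x => f x.1 x.2 = y).card ≤
      (Z.filter fun φ => x₀.2 ⊆ V φ ∧ f φ x₀.2 = y).card := by
    refine Finset.card_le_card_of_injOn (fun x => x.1) (fun x hx => ?_) fun x hx x' hx' e => ?_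
    · have h2 := hP x hx
      have hx := Finset.mem_coe.1 hx
      rw [Finset.mem_filter, hmem] at hx
      simp only [Finset.coe_filter, Set.mem_ofPred_eq]
      exact ⟨hx.1.1, h2 ▸ hx.1.2, h2 ▸ hx.2⟩
    · exact Sigma.ext e (heq_of_eq ((hP x hx).trans (hP x' hx').symm))
  calc ∑ x ∈ Θ.filter fun x => f x.1 x.2 = y, K⁻¹ ^ x.2.card
      = ∑ x ∈ Θ.filter fun x => f x.1 x.2 = y, K⁻¹ ^ x₀.2.card :=
        Finset.sum_congr rfl fun x hx => by rw [hP x hx]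
    _ = ((Θ.filter fun x => f x.1 x.2 = y).card : ℝ) * K⁻¹ ^ x₀.2.card := by
        rw [Finset.sum_const, nsmul_eq_mul]
    _ ≤ K ^ x₀.2.card * K⁻¹ ^ x₀.2.card := by
        gcongr
        exact (Nat.cast_le.2 hcard).trans (hfib _ _)
    _ = ((1 : ℕ) : ℝ) := by
        rw [inv_pow, mul_inv_cancel₀ (pow_pos hK _).ne', Nat.cast_one]

/-- If each `φ ∈ Z` is determined, up to `K ^ #(B φ)` possibilities, by a point of `T` and a set
`B φ` of small density, then `Z` is not much larger than `T`. -/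
theorem card_le_card_mul_of_small [DecidableEq Φ] [DecidableEq Ψ] [Fintype β] [DecidableEq β]
    (Z : Finset Φ) (T : Finset Ψ) (B : Φ → Finset β) (f : Φ → Ψ) {K t M : ℝ} (hK : 0 ≤ K)
    (ht : 0 < t) (ht1 : t ≤ 1) (hT : ∀ φ ∈ Z, f φ ∈ T) (hB : ∀ φ ∈ Z, ((B φ).card : ℝ) ≤ M)
    (hfib : ∀ P y, ((Z.filter fun φ => B φ = P ∧ f φ = y).card : ℝ) ≤ K ^ P.card) :
    (Z.card : ℝ) ≤ T.card * (t ^ (-M) * (1 + t * K) ^ Fintype.card β) := by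
  have h1 : (Z.card : ℝ) = ∑ y ∈ T, ∑ P : Finset β,
      ((Z.filter fun φ => B φ = P ∧ f φ = y).card : ℝ) := by
    rw [Finset.card_eq_sum_card_fiberwise (f := f) (t := T) hT, Nat.cast_sum]
    refine Finset.sum_congr rfl fun y _ => ?_
    rw [Finset.card_eq_sum_card_fiberwise (f := B) (t := Finset.univ)
      (fun _ _ => Finset.mem_coe.2 (Finset.mem_univ _)), Nat.cast_sum]
    refine Finset.sum_congr rfl fun P _ => ?_
    rw [Finset.filter_filter]
    simp only [and_comm]
  rw [h1, ← nsmul_eq_mul]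
  refine Finset.sum_le_card_nsmul _ _ _ fun y _ => ?_
  -- Since `t ≤ 1` and `#P ≤ M`, `K ^ #P ≤ t ^ (-M) * (t * K) ^ #P`, and the right side can be
  -- summed over all `P`.
  have h2 := Finset.sum_pow_mul_eq_add_pow (t * K) 1 (Finset.univ : Finset β)
  simp only [one_pow, mul_one, Finset.powerset_univ, Finset.card_univ] at h2
  rw [add_comm 1, ← h2, Finset.mul_sum]
  refine Finset.sum_le_sum fun P _ => ?_
  rcases (Z.filter fun φ => B φ = P ∧ f φ = y).eq_empty_or_nonempty with h | ⟨φ, hφ⟩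
  · rw [h]; simp only [Finset.card_empty, Nat.cast_zero]; positivity
  rw [Finset.mem_filter] at hφ
  have hM : (P.card : ℝ) ≤ M := hφ.2.1 ▸ hB φ hφ.1
  refine (hfib P y).trans ?_
  rw [mul_pow, ← mul_assoc, ← Real.rpow_natCast t, ← Real.rpow_add ht]
  refine le_mul_of_one_le_left (by positivity) ?_
  exact Real.one_le_rpow_of_pos_of_le_one_of_nonpos ht ht1 (by linarith)

end Counting

/-! ### Separated sets, nets and exponential rates. -/

section Separation

/-- A finite cover by small balls encodes points; labels on a set of sites then bound the number of
separated microstates that are controlled elsewhere. -/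
theorem exists_label (X : Type*) [MetricSpace X] [CompactSpace X] {ε : ℝ} (hε : 0 < ε) :
    ∃ K : ℕ, 0 < K ∧ ∃ l : X → Fin K, ∀ x y, l x = l y → dist x y < ε := by
  rcases isEmpty_or_nonempty X with h | ⟨⟨x₀⟩⟩
  · exact ⟨1, one_pos, fun _ => 0, fun x => h.elim x⟩
  obtain ⟨t, -, htf, ht⟩ := finite_cover_balls_of_compact (isCompact_univ (X := X)) (half_pos hε)
  have h : ∀ x : X, ∃ y : t, dist x y < ε / 2 := fun x => by
    simpa using ht (Set.mem_univ x)
  choose f hf using h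
  let _ := htf.fintype
  have : Nonempty t := ⟨f x₀⟩
  refine ⟨Fintype.card t, Fintype.card_pos, fun x => Fintype.equivFin t (f x), fun x y e => ?_⟩
  have e := (Fintype.equivFin t).injective e
  have h1 := hf x
  have h2 := hf y
  rw [← e] at h2
  linarith [dist_triangle_right x y (f x : X)]

variable {M : Type*} [MetricSpace M]

theorem sepNumber_le_ofReal {ε R : ℝ} (hR : 0 ≤ R) {S : Set M}
    (h : ∀ Z : Finset M, (Z : Set M) ⊆ S → (Z : Set M).Pairwise (fun φ ψ => ε ≤ dist φ ψ) →
      (Z.card : ℝ) ≤ R) :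
    ((sepNumber ε S : ℕ∞) : ENNReal) ≤ ENNReal.ofReal R := by
  have h1 : sepNumber ε S ≤ (⌊R⌋₊ : ℕ∞) := by
    refine iSup₂_le fun Z hZ => ?_
    by_contra! hlt
    have hle : ((⌊R⌋₊ + 1 : ℕ) : ℕ∞) ≤ Z.encard := by
      have := Order.add_one_le_of_lt hlt
      exact_mod_cast this
    obtain ⟨W, hWZ, hW⟩ := Set.exists_subset_encard_eq hle
    have hWf : W.Finite := Set.finite_of_encard_eq_coe hW
    have h2 := h hWf.toFinset (by simpa using hWZ.trans hZ.1)
      (by simpa using hZ.2.mono hWZ)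
    rw [hWf.encard_eq_coe_toFinset_card] at hW
    have hW : hWf.toFinset.card = ⌊R⌋₊ + 1 := by exact_mod_cast hW
    rw [hW] at h2
    push_cast at h2
    linarith [Nat.lt_floor_add_one R]
  calc ((sepNumber ε S : ℕ∞) : ENNReal) ≤ ((⌊R⌋₊ : ℕ∞) : ENNReal) := by exact_mod_cast h1
    _ = ENNReal.ofReal (⌊R⌋₊ : ℝ) := by simp
    _ ≤ ENNReal.ofReal R := ENNReal.ofReal_le_ofReal (Nat.floor_le hR)

theorem card_le_of_sepNumber_le {ε R : ℝ} (hR : 0 ≤ R) {S : Set M}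
    (h : ((sepNumber ε S : ℕ∞) : ENNReal) ≤ ENNReal.ofReal R) (Z : Finset M)
    (hZ : (Z : Set M) ⊆ S) (hsep : (Z : Set M).Pairwise fun φ ψ => ε ≤ dist φ ψ) :
    (Z.card : ℝ) ≤ R := by
  have h1 : ((Z : Set M).encard) ≤ sepNumber ε S :=
    le_iSup₂_of_le (Z : Set M) ⟨hZ, hsep⟩ le_rfl
  rw [Set.encard_coe_eq_coe_finsetCard] at h1
  have h2 : ((Z.card : ℕ∞) : ENNReal) ≤ ENNReal.ofReal R :=
    le_trans (by exact_mod_cast h1) h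
  have h3 : ENNReal.ofReal (Z.card : ℝ) ≤ ENNReal.ofReal R := by simpa using h2
  exact (ENNReal.ofReal_le_ofReal_iff hR).1 h3

/-- A maximal `ε`-separated subset is an `ε`-net. -/
theorem exists_net_of_sepNumber_le {ε R : ℝ} (hε : 0 < ε) (hR : 0 ≤ R) {S : Set M}
    (h : ((sepNumber ε S : ℕ∞) : ENNReal) ≤ ENNReal.ofReal R) :
    ∃ T : Finset M, (T.card : ℝ) ≤ R ∧ ∀ φ ∈ S, ∃ ψ ∈ T, dist φ ψ < ε := by
  classical
  let good : ℕ → Prop := fun n => ∃ T : Finset M, (T : Set M) ⊆ S ∧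
    (T : Set M).Pairwise (fun φ ψ => ε ≤ dist φ ψ) ∧ T.card = n
  have hb : ∀ n, good n → n ≤ ⌊R⌋₊ := by
    rintro n ⟨T, hTS, hT, rfl⟩
    exact Nat.le_floor (card_le_of_sepNumber_le hR h T hTS hT)
  have h0 : good 0 := ⟨∅, by simp, by simp, rfl⟩
  obtain ⟨T, hTS, hT, hTc⟩ := Nat.findGreatest_spec (P := good) (Nat.zero_le ⌊R⌋₊) h0
  refine ⟨T, card_le_of_sepNumber_le hR h T hTS hT, fun φ hφ => ?_⟩
  by_contra! hfar
  have hφT : φ ∉ T := fun hm => by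
    have := hfar φ hm
    rw [dist_self] at this
    linarith
  have hg : good (Nat.findGreatest good ⌊R⌋₊ + 1) := by
    refine ⟨insert φ T, ?_, ?_, by rw [Finset.card_insert_of_notMem hφT, hTc]⟩
    · rw [Finset.coe_insert]; exact Set.insert_subset hφ hTS
    · rw [Finset.coe_insert]
      refine hT.insert fun ψ hψ _ => ⟨hfar ψ hψ, ?_⟩
      rw [dist_comm]; exact hfar ψ hψ
  have := Nat.le_findGreatest (hb _ hg) hg
  omega

theorem one_div_mul_log_le_iff {d : ℕ} (hd : 0 < d) (N : ENNReal) (r : ℝ) :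
    ((1 / (d : ℝ) : ℝ) : EReal) * ENNReal.log N ≤ (r : EReal) ↔
      N ≤ ENNReal.ofReal (Real.exp (r * d)) := by
  have hd' : (0 : ℝ) < d := by exact_mod_cast hd
  rw [← ENNReal.log_le_log_iff, ENNReal.log_ofReal_of_pos (Real.exp_pos _), Real.log_exp]
  induction ENNReal.log N with
  | bot => rw [EReal.coe_mul_bot_of_pos (by positivity)]; simp
  | top => rw [EReal.coe_mul_top_of_pos (by positivity)]; simp [-EReal.coe_mul]
  | coe x =>
    rw [← EReal.coe_mul, EReal.coe_le_coe_iff, EReal.coe_le_coe_iff, one_div, inv_mul_le_iff₀ hd',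
      mul_comm]

end Separation

/-! ### Mean-square error against the density of bad sites. -/

section Rho

variable {X : Type*} [MetricSpace X]

/-- Chebyshev's inequality for `ρ₂`. -/
theorem card_filter_lt_dist_le {d : ℕ} {φ ψ : Fin d → X} {δ η : ℝ} (hη : 0 < η)
    (h : rho2 φ ψ < δ) :
    ((Finset.univ.filter fun a => η < dist (φ a) (ψ a)).card : ℝ) ≤ (δ / η) ^ 2 * d := by
  rcases Nat.eq_zero_or_pos d with rfl | hd
  · simp
  have hd' : (0 : ℝ) < d := by exact_mod_cast hd
  have hδ : 0 < δ := (Real.sqrt_nonneg _).trans_lt h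
  unfold rho2 at h
  rw [Real.sqrt_lt' hδ, one_div, inv_mul_lt_iff₀ hd'] at h
  have h1 : ((Finset.univ.filter fun a => η < dist (φ a) (ψ a)).card : ℝ) * η ^ 2 ≤
      ∑ a, dist (φ a) (ψ a) ^ 2 := by
    rw [← nsmul_eq_mul]
    refine (Finset.card_nsmul_le_sum _ (fun a => dist (φ a) (ψ a) ^ 2) _ fun a ha => ?_).trans
      (Finset.sum_le_sum_of_subset_of_nonneg (Finset.filter_subset _ _)
        fun _ _ _ => by positivity)
    exact pow_le_pow_left₀ hη.le (Finset.mem_filter.1 ha).2.le 2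
  rw [div_pow, div_mul_eq_mul_div, le_div_iff₀ (by positivity)]
  linarith

/-- Bad sites contribute at most `β * C ^ 2` to the mean square and the others at most `δ ^ 2 / 4`.
-/
theorem rho2_lt_of_card_le {d : ℕ} (hd : 0 < d) {φ ψ : Fin d → X} {δ C β : ℝ} (hδ : 0 < δ)
    (hC : ∀ x y : X, dist x y ≤ C) (hβ : β * C ^ 2 < δ ^ 2 / 2) (B : Finset (Fin d))
    (hB : (B.card : ℝ) ≤ β * d) (h : ∀ a, a ∉ B → dist (φ a) (ψ a) ≤ δ / 2) :
    rho2 φ ψ < δ := by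
  have hd' : (0 : ℝ) < d := by exact_mod_cast hd
  unfold rho2
  rw [Real.sqrt_lt' hδ, one_div, inv_mul_lt_iff₀ hd',
    ← Finset.sum_add_sum_compl B fun a => dist (φ a) (ψ a) ^ 2]
  have h1 : ∑ a ∈ B, dist (φ a) (ψ a) ^ 2 ≤ B.card * C ^ 2 := by
    rw [← nsmul_eq_mul]
    exact Finset.sum_le_card_nsmul _ _ _ fun a _ => pow_le_pow_left₀ dist_nonneg (hC _ _) 2
  have h2 : ∑ a ∈ Bᶜ, dist (φ a) (ψ a) ^ 2 ≤ d * (δ / 2) ^ 2 := by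
    refine (Finset.sum_le_card_nsmul _ _ ((δ / 2) ^ 2) fun a ha =>
      pow_le_pow_left₀ dist_nonneg (h a (Finset.mem_compl.1 ha)) 2).trans ?_
    rw [nsmul_eq_mul]
    gcongr
    exact_mod_cast (Finset.card_le_univ _).trans_eq (Fintype.card_fin d)
  have h3 : (B.card : ℝ) * C ^ 2 ≤ β * d * C ^ 2 := by gcongr
  nlinarith [mul_pos hd' (pow_pos hδ 2)]

end Rho

/-! ### Uniform expansivity and bad sites of a microstate. -/

section Expansive

variable {G X : Type*} [Group G] [MetricSpace X] [MulAction G X]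

/-- The pairs at distance at least `ε` form a compact set, covered by the open sets of pairs that
some `g` separates by more than `c`; a finite subcover gives `E`. The same `c` serves every `ε`. -/
theorem IsExpansive.exists_finset [CompactSpace X] [ContinuousConstSMul G X]
    (h : IsExpansive G X) : ∃ c : ℝ, 0 < c ∧ ∀ ε : ℝ, 0 < ε → ∃ E : Finset G,
      ∀ x y : X, (∀ u ∈ E, dist (u • x) (u • y) ≤ c) → dist x y < ε := by
  obtain ⟨c, hc, h⟩ := h
  refine ⟨c, hc, fun ε hε => ?_⟩
  have hcomp : IsCompact {p : X × X | ε ≤ dist p.1 p.2} :=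
    (isClosed_le continuous_const (by fun_prop)).isCompact
  obtain ⟨E, hE⟩ := hcomp.elim_finite_subcover
    (fun g : G => {p : X × X | c < dist (g • p.1) (g • p.2)})
    (fun g => isOpen_lt continuous_const (by fun_prop)) (by
      intro p hp
      have hne : p.1 ≠ p.2 := fun e => by
        have hp : ε ≤ dist p.1 p.2 := hp
        rw [e, dist_self] at hp
        linarith
      obtain ⟨g, hg⟩ := h _ _ hne
      exact Set.mem_iUnion.2 ⟨g, hg⟩)
  refine ⟨E, fun x y hxy => ?_⟩
  by_contra! hlt
  have hmem : (x, y) ∈ {p : X × X | ε ≤ dist p.1 p.2} := hlt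
  obtain ⟨u, hu, hlt'⟩ := Set.mem_iUnion₂.1 (hE hmem)
  exact absurd (hxy u hu) (not_le.2 hlt')

theorem card_filter_exists_lt_dist_le {d : ℕ} {σ : G → Equiv.Perm (Fin d)} {F E : Finset G}
    {δ η : ℝ} (hη : 0 < η) (hEF : E ⊆ F) {φ : Fin d → X} (hφ : φ ∈ soficMaps X F δ σ) :
    ((Finset.univ.filter fun a => ∃ u ∈ E, η < dist (φ (σ u a)) (u • φ a)).card : ℝ) ≤
      E.card * (δ / η) ^ 2 * d := by
  classical
  have h1 : (Finset.univ.filter fun a => ∃ u ∈ E, η < dist (φ (σ u a)) (u • φ a)) ⊆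
      E.biUnion fun u => Finset.univ.filter fun a => η < dist (φ (σ u a)) (u • φ a) := by
    intro a ha
    simpa using ha
  have h2 : ((E.biUnion fun u =>
      Finset.univ.filter fun a => η < dist (φ (σ u a)) (u • φ a)).card : ℝ) ≤
      ∑ u ∈ E, ((Finset.univ.filter fun a => η < dist (φ (σ u a)) (u • φ a)).card : ℝ) := by
    exact_mod_cast Finset.card_biUnion_le
  refine (Nat.cast_le.2 (Finset.card_le_card h1)).trans (h2.trans ?_)
  rw [mul_assoc, ← nsmul_eq_mul]
  exact Finset.sum_le_card_nsmul _ _ _ fun u hu => card_filter_lt_dist_le hη (hφ u (hEF hu))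

theorem soficMaps_mono {d : ℕ} {σ : G → Equiv.Perm (Fin d)} {F F' : Finset G} {δ δ' : ℝ}
    (hF : F ⊆ F') (hδ : δ' ≤ δ) : soficMaps X F' δ' σ ⊆ soficMaps X F δ σ :=
  fun _ h s hs => (h s (hF hs)).trans_le hδ

end Expansive

/-! ### Entropy at a fixed scale. -/

section Entropy

variable {G : Type*} [Group G]

/-- The sofic entropy at scale `ε`. -/
noncomputable def scaleEntropy (S : SoficApproximation G) (X : Type*) [MetricSpace X]
    [MulAction G X] (ε : ℝ) : EReal :=
  ⨅ (F : Finset G) (_ : F.Nonempty), ⨅ (δ : ℝ) (_ : 0 < δ),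
    limsup (fun j => ((1 / (S.d j : ℝ) : ℝ) : EReal) *
      ENNReal.log ((sepNumber ε (soficMaps X F δ (S.σ j)) : ℕ∞) : ENNReal)) atTop

variable {X : Type*} [MetricSpace X] [MulAction G X] (S : SoficApproximation G)

theorem scaleEntropy_le_soficEntropy {ε : ℝ} (hε : 0 < ε) :
    scaleEntropy S X ε ≤ soficEntropy S X :=
  le_iSup₂ (f := fun (ε : ℝ) (_ : 0 < ε) => scaleEntropy S X ε) ε hε

theorem exists_of_scaleEntropy_lt {ε r : ℝ} (h : scaleEntropy S X ε < (r : EReal)) :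
    ∃ F : Finset G, F.Nonempty ∧ ∃ δ : ℝ, 0 < δ ∧ ∀ᶠ j in atTop,
      ((sepNumber ε (soficMaps X F δ (S.σ j)) : ℕ∞) : ENNReal) ≤
        ENNReal.ofReal (Real.exp (r * S.d j)) := by
  unfold scaleEntropy at h
  simp only [iInf_lt_iff] at h
  obtain ⟨F, hF, δ, hδ, h⟩ := h
  refine ⟨F, hF, δ, hδ, (eventually_lt_of_limsup_lt h).mono fun j hj => ?_⟩
  exact (one_div_mul_log_le_iff (S.d_pos j) _ _).1 hj.le

theorem scaleEntropy_le {ε r δ : ℝ} {F : Finset G} (hF : F.Nonempty) (hδ : 0 < δ)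
    (h : ∀ᶠ j in atTop, ∀ Z : Finset (Fin (S.d j) → X), (Z : Set _) ⊆ soficMaps X F δ (S.σ j) →
      (Z : Set (Fin (S.d j) → X)).Pairwise (fun φ ψ => ε ≤ dist φ ψ) →
      (Z.card : ℝ) ≤ Real.exp (r * S.d j)) :
    scaleEntropy S X ε ≤ (r : EReal) := by
  refine (iInf₂_le_of_le F hF (iInf₂_le δ hδ)).trans ?_
  refine limsup_le_of_le (h := h.mono fun j hj => ?_)
  exact (one_div_mul_log_le_iff (S.d_pos j) _ _).2 (sepNumber_le_ofReal (Real.exp_pos _).le hj)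

/-- A weight `t` and a density `τ` for which the error in `card_le_card_mul_of_small` has
exponential growth rate at most `η`. -/
theorem exists_small_rate {η K : ℝ} (hη : 0 < η) (hK : 0 < K) :
    ∃ t τ : ℝ, 0 < t ∧ t ≤ 1 ∧ 0 < τ ∧ ∀ d : ℕ,
      t ^ (-(τ * d)) * (1 + t * K) ^ d ≤ Real.exp (η * d) := by
  obtain ⟨t, ht0, ht1, htK⟩ : ∃ t : ℝ, 0 < t ∧ t ≤ 1 ∧ t * K ≤ η / 2 :=
    -- Half of `η` absorbs `log (1 + t * K) ≤ t * K`; the other half absorbs `-τ * log t`. The `+ 1`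
    -- in the denominator of `τ` covers `t = 1`.
    ⟨min 1 (η / 2 / K), by positivity, min_le_left _ _, by
      rw [← le_div_iff₀ hK]; exact min_le_right _ _⟩
  have hlog : 0 ≤ -Real.log t := neg_nonneg.2 (Real.log_nonpos ht0.le ht1)
  refine ⟨t, η / 2 / (-Real.log t + 1), ht0, ht1, by positivity, fun d => ?_⟩
  set τ := η / 2 / (-Real.log t + 1) with hτ
  have hτ1 : τ * (-Real.log t) ≤ η / 2 := by
    rw [hτ, div_mul_eq_mul_div, div_le_iff₀ (by positivity)]
    nlinarith
  have h1 : t ^ (-(τ * d)) ≤ Real.exp (η / 2 * d) := by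
    rw [Real.rpow_def_of_pos ht0]
    refine Real.exp_le_exp.2 ?_
    have := mul_le_mul_of_nonneg_right hτ1 (Nat.cast_nonneg (α := ℝ) d)
    linarith
  have h2 : (1 + t * K) ^ d ≤ Real.exp (η / 2 * d) := by
    rw [mul_comm (η / 2), Real.exp_nat_mul]
    refine pow_le_pow_left₀ (by positivity) ?_ d
    linarith [Real.add_one_le_exp (η / 2)]
  calc _ ≤ Real.exp (η / 2 * d) * Real.exp (η / 2 * d) :=
        mul_le_mul h1 h2 (by positivity) (Real.exp_pos _).le
    _ = Real.exp (η * d) := by rw [← Real.exp_add]; ring_nf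

theorem exists_small_tolerance (n : ℕ) {η τ : ℝ} (hη : 0 < η) (hτ : 0 < τ) :
    ∃ δ : ℝ, 0 < δ ∧ ∀ δ', 0 ≤ δ' → δ' ≤ δ → n * (δ' / η) ^ 2 ≤ τ := by
  refine ⟨η * Real.sqrt (τ / (n + 1)), by positivity, fun δ' h0 hδ' => ?_⟩
  have h1 : δ' / η ≤ Real.sqrt (τ / (n + 1)) := by rwa [div_le_iff₀' hη]
  have h2 : (δ' / η) ^ 2 ≤ τ / (n + 1) :=
    (pow_le_pow_left₀ (by positivity) h1 2).trans_eq (Real.sq_sqrt (by positivity))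
  calc (n : ℝ) * (δ' / η) ^ 2 ≤ (n + 1) * (τ / (n + 1)) := by gcongr; linarith
    _ = τ := by field_simp

variable [CompactSpace X]

/-- The entropy of an expansive system is computed at a fixed scale. -/
theorem scaleEntropy_le_of_expansive {c : ℝ} (hc : 0 < c)
    (hE : ∀ ε : ℝ, 0 < ε → ∃ E : Finset G,
      ∀ x y : X, (∀ u ∈ E, dist (u • x) (u • y) ≤ c) → dist x y < ε) {ε : ℝ} (hε : 0 < ε) :
    scaleEntropy S X ε ≤ scaleEntropy S X (c / 4) := by
  classical
  refine EReal.le_of_forall_lt_iff_le.1 fun r' hr' => ?_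
  obtain ⟨r, hr, hrr⟩ := EReal.lt_iff_exists_real_btwn.1 hr'
  have hrr : r < r' := EReal.coe_lt_coe_iff.1 hrr
  obtain ⟨F, hF, δ, hδ, hev⟩ := exists_of_scaleEntropy_lt S hr
  obtain ⟨K, hK, l, hl⟩ := exists_label X hε
  have hK' : (0 : ℝ) < K := by exact_mod_cast hK
  obtain ⟨E, hE⟩ := hE ε hε
  obtain ⟨t, τ, ht, ht1, hτ, hrate⟩ := exists_small_rate (sub_pos.2 hrr) hK'
  obtain ⟨δ₁, hδ₁, htol⟩ := exists_small_tolerance E.card (show 0 < c / 4 by positivity) hτ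
  set δ' := min δ δ₁
  have hδ'0 : 0 < δ' := lt_min hδ hδ₁
  have hδ'1 : E.card * (δ' / (c / 4)) ^ 2 ≤ τ := htol _ hδ'0.le (min_le_right _ _)
  refine scaleEntropy_le S (F := F ∪ E) (δ := δ') (hF.mono Finset.subset_union_left) hδ'0
    (hev.mono fun j hj Z hZ hsep => ?_)
  obtain ⟨T, hTc, hT⟩ := exists_net_of_sepNumber_le (by positivity) (Real.exp_pos _).le hj
  have hZ1 : ∀ φ ∈ Z, ∃ ψ ∈ T, dist φ ψ < c / 4 := fun φ hφ =>
    hT φ (soficMaps_mono Finset.subset_union_left (min_le_left _ _) (hZ hφ))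
  choose! f hfT hf using hZ1
  -- `φ` is recovered from its net point, its bad set and labels on that set: at a good site, four
  -- errors of at most `c / 4` give distance at most `c` after every `u ∈ E`, hence less than `ε`.
  have key := card_le_card_mul_of_small Z T
    (fun φ => Finset.univ.filter fun a => ∃ u ∈ E, c / 4 < dist (φ (S.σ j u a)) (u • φ a))
    f hK'.le ht ht1 hfT (M := τ * S.d j)
    (fun φ hφ => (card_filter_exists_lt_dist_le (by positivity) Finset.subset_union_right
      (hZ hφ)).trans (by gcongr)) (fun P y => by
        rw [← Nat.cast_pow]
        refine Nat.cast_le.2 (card_le_pow_of_label _ P (fun φ b => l (φ b)) ?_)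
        intro φ hφ ψ hψ hlab
        rw [Finset.mem_filter] at hφ hψ
        obtain ⟨hφ, hφP, rfl⟩ := hφ
        obtain ⟨hψ, hψP, hfe⟩ := hψ
        by_contra hne
        refine absurd (hsep hφ hψ hne) (not_le.2 ((dist_pi_lt_iff hε).2 fun a => ?_))
        by_cases ha : a ∈ P
        · exact hl _ _ (hlab a ha)
        · refine hE _ _ fun u hu => ?_
          have h1 : ∀ b, dist (φ b) (f φ b) < c / 4 := fun b =>
            (dist_le_pi_dist _ _ b).trans_lt (hf φ hφ)
          have h2 : ∀ b, dist (ψ b) (f φ b) < c / 4 := fun b =>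
            hfe ▸ (dist_le_pi_dist _ _ b).trans_lt (hf ψ hψ)
          have h3 : dist (φ (S.σ j u a)) (u • φ a) ≤ c / 4 := by
            by_contra! h
            exact ha (hφP ▸ Finset.mem_filter.2 ⟨Finset.mem_univ _, u, hu, h⟩)
          have h4 : dist (ψ (S.σ j u a)) (u • ψ a) ≤ c / 4 := by
            by_contra! h
            exact ha (hψP ▸ Finset.mem_filter.2 ⟨Finset.mem_univ _, u, hu, h⟩)
          have h5 := h1 (S.σ j u a)
          have h6 := h2 (S.σ j u a)
          have h7 := dist_triangle4_right (u • φ a) (u • ψ a) (φ (S.σ j u a)) (ψ (S.σ j u a))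
          have h8 := dist_triangle_right (φ (S.σ j u a)) (ψ (S.σ j u a)) (f φ (S.σ j u a))
          rw [dist_comm (u • φ a) (φ _), dist_comm (u • ψ a) (ψ _)] at h7
          linarith)
  rw [Fintype.card_fin] at key
  calc (Z.card : ℝ) ≤ _ := key
    _ ≤ Real.exp (r * S.d j) * Real.exp ((r' - r) * S.d j) :=
        mul_le_mul hTc (hrate _) (by positivity) (Real.exp_pos _).le
    _ = Real.exp (r' * S.d j) := by rw [← Real.exp_add]; ring_nf

/-- With `K` labels per site a separated set has at most `K ^ d` elements, whatever the microstate
condition. -/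
theorem scaleEntropy_lt_top {ε : ℝ} (hε : 0 < ε) : scaleEntropy S X ε < ⊤ := by
  classical
  obtain ⟨K, hK, l, hl⟩ := exists_label X hε
  have hK' : (0 : ℝ) < K := by exact_mod_cast hK
  refine (scaleEntropy_le S (F := {1}) (δ := 1) (r := Real.log K) (Finset.singleton_nonempty _)
    one_pos (Eventually.of_forall fun j Z _ hsep => ?_)).trans_lt (EReal.coe_lt_top _)
  have := card_le_pow_of_label Z Finset.univ (fun φ b => l (φ b)) fun φ hφ ψ hψ h => by
    by_contra hne
    exact absurd (hsep hφ hψ hne)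
      (not_le.2 ((dist_pi_lt_iff hε).2 fun a => hl _ _ (h a (Finset.mem_univ a))))
  rw [Finset.card_univ, Fintype.card_fin] at this
  rw [mul_comm, Real.exp_nat_mul, Real.exp_log hK']
  exact_mod_cast this

theorem soficEntropy_le_scaleEntropy {c : ℝ} (hc : 0 < c)
    (hE : ∀ ε : ℝ, 0 < ε → ∃ E : Finset G,
      ∀ x y : X, (∀ u ∈ E, dist (u • x) (u • y) ≤ c) → dist x y < ε) :
    soficEntropy S X ≤ scaleEntropy S X (c / 4) :=
  iSup₂_le fun _ hε => scaleEntropy_le_of_expansive S hc hE hε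

end Entropy

/-! ### Altering microstates along a separated set. -/

section Modification

variable {G X : Type*} [Group G] [MetricSpace X] [MulAction G X]

/-- At `b`, the map `σ` is multiplicative and free on `U`, and `φ` is equivariant up to `δ`. -/
def IsGoodAt {d : ℕ} (σ : G → Equiv.Perm (Fin d)) (U : Finset G) (δ : ℝ) (φ : Fin d → X)
    (b : Fin d) : Prop :=
  (∀ s ∈ U, ∀ t ∈ U, σ s (σ t b) = σ (s * t) b) ∧
    (∀ s ∈ U, ∀ t ∈ U, σ s b = σ t b → s = t) ∧ ∀ s ∈ U, dist (φ (σ s b)) (s • φ b) ≤ δ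

/-- A sofic microstate `φ` can be modified near a separated set `P` of good sites, so as to be
close to `x₀` on `P`, while staying approximately equivariant. -/
theorem exists_modification [DecidableEq G] (hspec : WeakSpecification G X)
    (hmarkov : StrongTopologicalMarkov G X) (x₀ : X) {ε : ℝ} (hε : 0 < ε) :
    ∃ A D : Finset G, (∀ s ∈ A, s⁻¹ ∈ D) ∧ ∃ δ : ℝ, 0 < δ ∧
      ∀ E F' : Finset G, ∃ U : Finset G, ∀ (d : ℕ) (σ : G → Equiv.Perm (Fin d)) (φ : Fin d → X)
        (P : Finset (Fin d)), (∀ a ∈ P, IsGoodAt σ U δ φ a) →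
        (∀ a ∈ P, ∀ a' ∈ P, ∀ w ∈ D, σ w a = a' → a = a') →
        ∃ q : Fin d → X, (∀ b, (∀ s ∈ A, σ s⁻¹ b ∉ P) → dist (q b) (φ b) ≤ ε) ∧
          (∀ a ∈ P, dist (q a) x₀ ≤ 2 * ε) ∧
          ∀ t ∈ F', ∀ b, IsGoodAt σ U δ φ b → IsGoodAt σ U δ φ (σ t b) →
            ∀ u ∈ E, dist (u • q (σ t b)) (u • t • q b) ≤ 4 * ε := by
  obtain ⟨δ₀, hδ₀, F, hglue⟩ := exists_glue hspec hmarkov hε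
  obtain ⟨A, hA1, hrep⟩ := exists_replace hspec hmarkov x₀ (lt_min hε (half_pos hδ₀))
  choose Z hZ₀ hZ using hrep
  obtain ⟨D, hglue⟩ := hglue A
  refine ⟨A, D ∪ A⁻¹, fun s hs => Finset.mem_union_right _ (Finset.inv_mem_inv hs),
    min ε (δ₀ / 4), lt_min hε (by positivity), fun E F' => ?_⟩
  -- Replacement costs `δ₀ / 2` and the two equivariance errors at most `δ₀ / 4` each, within the
  -- tolerance `δ₀` of `hglue`.
  set δ := min ε (δ₀ / 4)
  have hδε : δ ≤ ε := min_le_left _ _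
  have hδδ₀ : δ ≤ δ₀ / 4 := min_le_right _ _
  -- `V` contains every `s` whose alteration can be seen from some `u ∈ insert 1 E`; `W` also
  -- contains `V * F'`, so that `b` and `σ t b` see the same sites of `P`.
  set V := A⁻¹ * insert 1 E with hVdef
  set W := V * insert 1 F' with hWdef
  set U := W ∪ D ∪ F * A ∪ F * A * W ∪ insert 1 E ∪ insert 1 E * insert 1 F' ∪ insert 1 F'
    with hU
  have hAV : ∀ g, ∀ u ∈ insert 1 E, u * g⁻¹ ∈ A → g ∈ V := fun g u hu hg => by
    have := Finset.mul_mem_mul (Finset.inv_mem_inv hg) hu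
    simpa using this
  have hVW : ∀ s ∈ V, s ∈ W := fun s hs => by
    have := Finset.mul_mem_mul hs (Finset.mem_insert_self 1 F')
    simpa using this
  have hVtW : ∀ s ∈ V, ∀ t ∈ F', s * t ∈ W := fun s hs t ht =>
    Finset.mul_mem_mul hs (Finset.mem_insert_of_mem ht)
  have hWU : ∀ s ∈ W, s ∈ U := fun s hs => by simp only [hU, Finset.mem_union]; tauto
  have hDU : ∀ s ∈ D, s ∈ U := fun s hs => by simp only [hU, Finset.mem_union]; tauto
  have hFAU : ∀ s ∈ F * A, s ∈ U := fun s hs => by simp only [hU, Finset.mem_union]; tauto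
  have hFAWU : ∀ g ∈ F * A, ∀ s ∈ W, g * s ∈ U := fun g hg s hs => by
    have := Finset.mul_mem_mul hg hs
    simp only [hU, Finset.mem_union]; tauto
  have hEU : ∀ s ∈ insert 1 E, s ∈ U := fun s hs => by simp only [hU, Finset.mem_union]; tauto
  have hFU : ∀ s ∈ insert 1 F', s ∈ U := fun s hs => by simp only [hU, Finset.mem_union]; tauto
  have hEFU : ∀ u ∈ insert 1 E, ∀ t ∈ insert 1 F', u * t ∈ U := fun u hu t ht => by
    have := Finset.mul_mem_mul hu ht
    simp only [hU, Finset.mem_union]; tauto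
  have h1E : (1 : G) ∈ insert 1 E := Finset.mem_insert_self _ _
  have h1W : (1 : G) ∈ W := hVW 1 (hAV 1 1 h1E (by simpa using hA1))
  refine ⟨U, fun d σ φ P hP hsep => ?_⟩
  have hlocal : ∀ b, ∃ q : X, (¬ IsGoodAt σ U δ φ b → q = φ b) ∧ (IsGoodAt σ U δ φ b →
      (∀ s ∈ W, σ s b ∈ P → ∀ g ∈ A, dist ((g * s) • q) (g • Z (φ (σ s b))) ≤ ε) ∧
        ∀ g : G, (∀ s ∈ W, σ s b ∈ P → g * s⁻¹ ∉ A) → dist (g • q) (g • φ b) ≤ ε) := by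
    intro b
    by_cases hb : IsGoodAt σ U δ φ b
    swap
    · exact ⟨φ b, fun _ => rfl, fun h => absurd h hb⟩
    -- If `t * s⁻¹ ∈ D`, then `D` moves `σ s b` to `σ t b`, both in `P`; separation makes them equal
    -- and freeness at `b` gives `s = t`.
    obtain ⟨q, hq, hq'⟩ := hglue (W.filter fun s => σ s b ∈ P) (φ b) (fun s => Z (φ (σ s b)))
      (by
        intro s hs t ht hst hD
        rw [Finset.mem_filter] at hs ht
        have h1 : σ (t * s⁻¹) (σ s b) = σ t b := by
          rw [hb.1 _ (hDU _ hD) _ (hWU _ hs.1), inv_mul_cancel_right]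
        exact hst (hb.2.1 _ (hWU _ hs.1) _ (hWU _ ht.1)
          (hsep _ hs.2 _ ht.2 _ (Finset.mem_union_left _ hD) h1)))
      (by
        intro s hs g hg hgA
        rw [Finset.mem_filter] at hs
        have h1 := (hZ (φ (σ s b)) g hgA).trans (min_le_right _ _)
        have h2 := (hP _ hs.2).2.2 g (hFAU g hg)
        have h3 := hb.2.2 (g * s) (hFAWU g hg s hs.1)
        rw [← hb.1 g (hFAU g hg) s (hWU s hs.1), mul_smul] at h3
        have h4 := dist_triangle (g • Z (φ (σ s b))) (g • φ (σ s b)) (g • s • φ b)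
        have h5 := dist_triangle_left (g • φ (σ s b)) (g • s • φ b) (φ (σ g (σ s b)))
        linarith)
    refine ⟨q, fun h => absurd hb h, fun _ => ⟨fun s hs hsP => hq s ?_, fun g hg => hq' g ?_⟩⟩
    · exact Finset.mem_filter.2 ⟨hs, hsP⟩
    · intro s hs
      exact hg s (Finset.mem_filter.1 hs).1 (Finset.mem_filter.1 hs).2
  choose q hqbad hqgood using hlocal
  refine ⟨q, fun b hb => ?_, fun a ha => ?_, fun t ht b hb hb' u hu => ?_⟩
  · by_cases hg : IsGoodAt σ U δ φ b
    · have := (hqgood b hg).2 1 fun s _ hsP hsA => hb _ hsA (by simpa using hsP)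
      simpa using this
    · rw [hqbad b hg, dist_self]; exact hε.le
  · have h1 : σ 1 a = a := by
      have := (hP a ha).1 1 (hWU 1 h1W) 1 (hWU 1 h1W)
      rw [mul_one] at this
      exact (σ 1).injective this
    have h2 := (hqgood a (hP a ha)).1 1 h1W (by rwa [h1]) 1 hA1
    rw [h1, mul_one, one_smul, one_smul] at h2
    have h3 := (hZ₀ (φ a)).trans (min_le_left _ _)
    linarith [dist_triangle (q a) (Z (φ a)) x₀]
  · have hu' : u ∈ insert 1 E := Finset.mem_insert_of_mem hu
    have ht' : t ∈ insert 1 F' := Finset.mem_insert_of_mem ht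
    rw [← mul_smul]
    -- Either `u` sees an altered site and both points follow the same replacement, or neither is
    -- altered there and both follow `φ`, at total cost `2 * ε + 2 * δ`.
    by_cases h : ∃ s ∈ W, σ s (σ t b) ∈ P ∧ u * s⁻¹ ∈ A
    · obtain ⟨s, hs, hsP, hsA⟩ := h
      have hsV := hAV s u hu' hsA
      have hst : σ s (σ t b) = σ (s * t) b := hb.1 s (hWU s hs) t (hFU t ht')
      have h1 := (hqgood _ hb').1 s hs hsP _ hsA
      have h2 := (hqgood _ hb).1 (s * t) (hVtW s hsV t ht) (hst ▸ hsP) _ hsA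
      rw [inv_mul_cancel_right] at h1
      rw [← mul_assoc, inv_mul_cancel_right, ← hst] at h2
      linarith [dist_triangle_right (u • q (σ t b)) ((u * t) • q b)
        ((u * s⁻¹) • Z (φ (σ s (σ t b))))]
    · push Not at h
      have h1 := (hqgood _ hb').2 u h
      have h2 := (hqgood _ hb).2 (u * t) fun s hs hsP hsA => by
        have hsA' : u * (s * t⁻¹)⁻¹ ∈ A := by
          rwa [mul_inv_rev, inv_inv, ← mul_assoc]
        have hsV := hAV _ u hu' hsA'
        refine h (s * t⁻¹) (hVW _ hsV) ?_ hsA'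
        rw [hb.1 _ (hWU _ (hVW _ hsV)) t (hFU t ht'), inv_mul_cancel_right]
        exact hsP
      have h3 := hb'.2.2 u (hEU u hu')
      have h4 := hb.2.2 (u * t) (hEFU u hu' t ht')
      rw [← hb.1 u (hEU u hu') t (hFU t ht')] at h4
      have h5 := dist_triangle4_right (u • q (σ t b)) ((u * t) • q b) (u • φ (σ t b))
        ((u * t) • φ b)
      have h6 := dist_triangle_left (u • φ (σ t b)) ((u * t) • φ b) (φ (σ u (σ t b)))
      linarith

/-- A maximal subset of `[d]` none of whose points is moved to another one by `D`. -/
theorem exists_separated {ι : Type*} {d : ℕ} (σ : ι → Equiv.Perm (Fin d)) (D : Finset ι) :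
    ∃ V : Finset (Fin d), (∀ a ∈ V, ∀ a' ∈ V, ∀ w ∈ D, σ w a = a' → a = a') ∧
      d ≤ (2 * D.card + 1) * V.card := by
  classical
  obtain ⟨V, hV, hmax⟩ := Finset.exists_max_image
    (Finset.univ.filter fun V : Finset (Fin d) =>
      ∀ a ∈ V, ∀ a' ∈ V, ∀ w ∈ D, σ w a = a' → a = a') Finset.card ⟨∅, by simp⟩
  have hV := (Finset.mem_filter.1 hV).2
  refine ⟨V, hV, ?_⟩
  -- By maximality, each `b ∉ V` is reached from `V` by some `σ w` or its inverse, whence the factor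
  -- 2.
  have hcov : (Finset.univ : Finset (Fin d)) ⊆
      V ∪ (V.biUnion (fun a => D.image fun w => σ w a) ∪
        V.biUnion fun a => D.image fun w => (σ w).symm a) := by
    intro b _
    by_contra hb
    simp only [Finset.mem_union, Finset.mem_biUnion, Finset.mem_image, not_or, not_exists,
      not_and] at hb
    obtain ⟨hbV, hb1, hb2⟩ := hb
    have := hmax (insert b V) (Finset.mem_filter.2 ⟨Finset.mem_univ _, by
      intro a ha a' ha' w hw h
      rw [Finset.mem_insert] at ha ha'
      rcases ha with rfl | ha <;> rcases ha' with rfl | ha'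
      · rfl
      · exact absurd ((Equiv.symm_apply_eq _).2 h.symm) (hb2 a' ha' w hw)
      · exact absurd h (hb1 a ha w hw)
      · exact hV a ha a' ha' w hw h⟩)
    rw [Finset.card_insert_of_notMem hbV] at this
    omega
  have h1 : ∀ f : Fin d → ι → Fin d,
      (V.biUnion fun a => D.image fun w => f a w).card ≤ V.card * D.card := fun f =>
    Finset.card_biUnion_le_card_mul _ _ _ fun a _ => Finset.card_image_le
  have h2 := Finset.card_le_card hcov
  rw [Finset.card_univ, Fintype.card_fin] at h2
  have h3 := h1 fun a w => σ w a
  have h4 := h1 fun a w => (σ w).symm a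
  have h5 := Finset.card_union_le V (V.biUnion (fun a => D.image fun w => σ w a) ∪
        V.biUnion fun a => D.image fun w => (σ w).symm a)
  have h6 := Finset.card_union_le (V.biUnion fun a => D.image fun w => σ w a)
        (V.biUnion fun a => D.image fun w => (σ w).symm a)
  calc d ≤ V.card + (V.card * D.card + V.card * D.card) := by omega
    _ = _ := by ring

/-- Along a sofic approximation, the proportion of points where multiplicativity or freeness on a
given finite set fails tends to zero. -/
theorem SoficApproximation.eventually_card_bad_le (S : SoficApproximation G) (U : Finset G)
    {β : ℝ} (hβ : 0 < β) : ∀ᶠ j in atTop, ∃ B : Finset (Fin (S.d j)), (B.card : ℝ) ≤ β * S.d j ∧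
      ∀ b ∉ B, (∀ s ∈ U, ∀ t ∈ U, S.σ j s (S.σ j t b) = S.σ j (s * t) b) ∧
        ∀ s ∈ U, ∀ t ∈ U, S.σ j s b = S.σ j t b → s = t := by
  classical
  -- Multiplicativity and freeness each contribute `#(U ×ˢ U)` exceptional sets of density at most
  -- `γ`.
  set γ := β / (2 * (U ×ˢ U).card + 1) with hγ
  have hγ0 : 0 < γ := by positivity
  have h1 : ∀ᶠ j in atTop, ∀ p ∈ U ×ˢ U,
      ((Finset.univ.filter fun b : Fin (S.d j) =>
        S.σ j p.1 (S.σ j p.2 b) ≠ S.σ j (p.1 * p.2) b).card : ℝ) ≤ γ * S.d j := by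
    refine (Filter.eventually_all_finset _).2 fun p _ => ?_
    refine ((S.tendsto_mul p.1 p.2).eventually (gt_mem_nhds hγ0)).mono fun j hj => ?_
    have hd : (0 : ℝ) < S.d j := by exact_mod_cast S.d_pos j
    unfold normHamming at hj
    rw [div_lt_iff₀ hd] at hj
    exact hj.le
  have h2 : ∀ᶠ j in atTop, ∀ p ∈ U ×ˢ U,
      ((Finset.univ.filter fun b : Fin (S.d j) =>
        p.1 ≠ p.2 ∧ S.σ j p.1 b = S.σ j p.2 b).card : ℝ) ≤ γ * S.d j := by
    refine (Filter.eventually_all_finset _).2 fun p _ => ?_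
    by_cases hp : p.1 = p.2
    · refine Eventually.of_forall fun j => ?_
      simp only [hp, ne_eq, not_true_eq_false, false_and, Finset.filter_false, Finset.card_empty,
        Nat.cast_zero]
      positivity
    refine ((S.tendsto_free p.1 p.2 hp).eventually
      (lt_mem_nhds (sub_lt_self 1 hγ0))).mono fun j hj => ?_
    have hd : (0 : ℝ) < S.d j := by exact_mod_cast S.d_pos j
    unfold normHamming at hj
    rw [lt_div_iff₀ hd] at hj
    have h3 := Finset.card_filter_add_card_filter_not (s := (Finset.univ : Finset (Fin (S.d j))))
      (fun b => S.σ j p.1 b = S.σ j p.2 b)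
    rw [Finset.card_univ, Fintype.card_fin] at h3
    have h4 : ((Finset.univ.filter fun b => S.σ j p.1 b = S.σ j p.2 b).card : ℝ) +
        (Finset.univ.filter fun b => ¬ S.σ j p.1 b = S.σ j p.2 b).card = S.d j := by
      exact_mod_cast h3
    simp only [hp, ne_eq, not_false_eq_true, true_and] at hj ⊢
    linarith
  filter_upwards [h1, h2] with j h1 h2
  refine ⟨((U ×ˢ U).biUnion fun p => Finset.univ.filter fun b : Fin (S.d j) =>
        S.σ j p.1 (S.σ j p.2 b) ≠ S.σ j (p.1 * p.2) b) ∪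
      (U ×ˢ U).biUnion fun p => Finset.univ.filter fun b : Fin (S.d j) =>
        p.1 ≠ p.2 ∧ S.σ j p.1 b = S.σ j p.2 b, ?_, fun b hb => ?_⟩
  · have key : ∀ f : G × G → Finset (Fin (S.d j)),
        (∀ p ∈ U ×ˢ U, ((f p).card : ℝ) ≤ γ * S.d j) →
        (((U ×ˢ U).biUnion f).card : ℝ) ≤ (U ×ˢ U).card * (γ * S.d j) := fun f hf => by
      rw [← nsmul_eq_mul]
      refine le_trans ?_ (Finset.sum_le_card_nsmul _ _ _ hf)
      exact_mod_cast Finset.card_biUnion_le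
    have h3 := key _ h1
    have h4 := key _ h2
    refine (Nat.cast_le.2 (Finset.card_union_le _ _)).trans ?_
    rw [Nat.cast_add]
    refine (add_le_add h3 h4).trans ?_
    have h5 : (2 * ((U ×ˢ U).card : ℝ) + 1) * γ = β := by rw [hγ]; field_simp
    have h6 : (0 : ℝ) ≤ γ * S.d j := by positivity
    rw [← h5]
    linarith
  · simp only [Finset.mem_union, Finset.mem_biUnion, Finset.mem_filter, Finset.mem_univ, true_and,
      Finset.mem_product, not_or, not_exists, not_and, Prod.forall, not_not, and_imp] at hb
    exact ⟨fun s hs t ht => hb.1 s t hs ht, fun s hs t ht h => by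
      by_contra hne
      exact hb.2 s t hs ht hne h⟩

end Modification

/-! ### The entropy gap. -/

section Subsystem

variable {G X : Type*} [Group G] [MetricSpace X] [CompactSpace X] [MulAction G X]

/-- The entropy of a subsystem avoiding a neighbourhood of `x₀` is smaller than the entropy of the
whole system by a definite amount. -/
theorem exists_scaleEntropy_gap (hspec : WeakSpecification G X)
    (hmarkov : StrongTopologicalMarkov G X) (S : SoficApproximation G) {c : ℝ} (hc : 0 < c)
    (hE : ∀ ε : ℝ, 0 < ε → ∃ E : Finset G,
      ∀ x y : X, (∀ u ∈ E, dist (u • x) (u • y) ≤ c) → dist x y < ε)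
    (Y : SubMulAction G X) (x₀ : X) {r : ℝ} (hr : 0 < r) (hY : ∀ y ∈ Y, r ≤ dist y x₀) :
    ∃ η : ℝ, 0 < η ∧ ∃ ε : ℝ, 0 < ε ∧ ∀ R : ℝ, scaleEntropy S X ε < (R : EReal) →
      scaleEntropy S Y (c / 4) ≤ ((R - η : ℝ) : EReal) := by
  classical
  -- The recovery of `φ` below needs `4 * ε < c / 4`, and that of `P` needs `5 * ε < r`.
  obtain ⟨ε, hε, hεc, hεr⟩ : ∃ ε : ℝ, 0 < ε ∧ ε ≤ c / 64 ∧ ε ≤ r / 16 :=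
    ⟨min (c / 64) (r / 16), by positivity, min_le_left _ _, min_le_right _ _⟩
  obtain ⟨A, D, hAD, δ₁, hδ₁, hmod⟩ := exists_modification hspec hmarkov x₀ hε
  obtain ⟨C, hC⟩ : ∃ C, ∀ x y : X, dist x y ≤ C := by
    obtain ⟨C, hC⟩ := Metric.isBounded_iff.1 (isCompact_univ (X := X)).isBounded
    exact ⟨C, fun x y => hC (Set.mem_univ x) (Set.mem_univ y)⟩
  obtain ⟨K₀, hK₀, l, hl⟩ := exists_label X (show 0 < c / 4 by positivity)
  have hK₀' : (0 : ℝ) < K₀ := by exact_mod_cast hK₀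
  set K : ℝ := (K₀ : ℝ) ^ A.card with hKdef
  have hK : 0 < K := by positivity
  set κ : ℝ := (2 * D.card + 1)⁻¹ with hκdef
  have hκ : 0 < κ := by positivity
  have hlog : 0 < Real.log (1 + K⁻¹) := Real.log_pos (by have := inv_pos.2 hK; linarith)
  -- The gap involves only `A`, `D` and the number of labels, all fixed before `R` and the
  -- parameters `F'`, `δ'` it determines.
  refine ⟨κ / 2 * Real.log (1 + K⁻¹), by positivity, ε, hε, fun R hR => ?_⟩
  obtain ⟨F', hF', δ', hδ', hev⟩ := exists_of_scaleEntropy_lt S hR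
  obtain ⟨E, hE⟩ := hE (δ' / 2) (half_pos hδ')
  obtain ⟨U, hU⟩ := hmod E F'
  -- The first bound leaves at least half of the guaranteed separated sites good; the second allows
  -- for `B` together with its preimage under `σ t`.
  obtain ⟨β, hβ, hβκ, hβC⟩ : ∃ β : ℝ, 0 < β ∧ β ≤ κ / 2 ∧ (2 * β) * C ^ 2 < δ' ^ 2 / 2 := by
    refine ⟨min (κ / 2) (δ' ^ 2 / (8 * (C ^ 2 + 1))), by positivity, min_le_left _ _, ?_⟩
    have h1 : min (κ / 2) (δ' ^ 2 / (8 * (C ^ 2 + 1))) * (8 * (C ^ 2 + 1)) ≤ δ' ^ 2 := by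
      rw [← le_div_iff₀ (by positivity)]; exact min_le_right _ _
    have h2 : 0 < min (κ / 2) (δ' ^ 2 / (8 * (C ^ 2 + 1))) := by positivity
    nlinarith [pow_pos hδ' 2]
  obtain ⟨δ, hδ, htol⟩ := exists_small_tolerance U.card hδ₁ (half_pos hβ)
  refine scaleEntropy_le S (F := insert 1 U) (Finset.insert_nonempty _ _) hδ ?_
  filter_upwards [hev, S.eventually_card_bad_le U (half_pos hβ)] with j hT hBσ Z hZ hsep
  obtain ⟨Bσ, hBσc, hBσ⟩ := hBσ
  obtain ⟨T, hTc, hT⟩ := exists_net_of_sepNumber_le hε (Real.exp_pos _).le hT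
  have hd : (0 : ℝ) < S.d j := by exact_mod_cast S.d_pos j
  -- `V` depends on `σ` alone, so the sets `P` and `Q` arising from different microstates are
  -- separated from each other too.
  obtain ⟨V, hVsep, hVcard⟩ := exists_separated (S.σ j) D
  have hVcard : κ * S.d j ≤ V.card := by
    rw [hκdef, inv_mul_le_iff₀ (by positivity)]
    exact_mod_cast hVcard
  have hbad : ∀ φ ∈ Z, ∃ B : Finset (Fin (S.d j)), (B.card : ℝ) ≤ β * S.d j ∧
      ∀ b ∉ B, IsGoodAt (S.σ j) U δ₁ (fun a => (φ a : X)) b := by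
    intro φ hφ
    have hφ' : (fun a => (φ a : X)) ∈ soficMaps X U δ (S.σ j) := fun s hs =>
      hZ hφ s (Finset.mem_insert_of_mem hs)
    have h1 := (card_filter_exists_lt_dist_le hδ₁ (Finset.Subset.refl U) hφ').trans
      (mul_le_mul_of_nonneg_right (htol δ hδ.le le_rfl) hd.le)
    refine ⟨Bσ ∪ Finset.univ.filter fun a =>
      ∃ u ∈ U, δ₁ < dist (φ (S.σ j u a) : X) (u • (φ a : X)),
      (Nat.cast_le.2 (Finset.card_union_le _ _)).trans ?_, fun b hb => ?_⟩
    · rw [Nat.cast_add]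
      linarith
    · rw [Finset.notMem_union] at hb
      refine ⟨(hBσ b hb.1).1, (hBσ b hb.1).2, fun s hs => ?_⟩
      by_contra! h
      exact hb.2 (Finset.mem_filter.2 ⟨Finset.mem_univ _, s, hs, h⟩)
  set W : (Fin (S.d j) → Y) → Finset (Fin (S.d j)) := fun φ =>
    V.filter fun a => IsGoodAt (S.σ j) U δ₁ (fun a => (φ a : X)) a with hW
  have hWcard : ∀ φ ∈ Z, ⌈κ / 2 * S.d j⌉₊ ≤ (W φ).card := by
    intro φ hφ
    obtain ⟨B, hB, hgood⟩ := hbad φ hφ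
    have h1 : V ⊆ W φ ∪ B := fun a ha => by
      by_cases hab : a ∈ B
      · exact Finset.mem_union_right _ hab
      · exact Finset.mem_union_left _ (Finset.mem_filter.2 ⟨ha, hgood a hab⟩)
    have h2 : (V.card : ℝ) ≤ (W φ).card + B.card := by
      exact_mod_cast (Finset.card_le_card h1).trans (Finset.card_union_le _ _)
    refine Nat.ceil_le.2 ?_
    have h3 := mul_le_mul_of_nonneg_right hβκ hd.le
    linarith
  have hex : ∀ φ ∈ Z, ∀ P ⊆ W φ, ∃ ψ ∈ T, ∃ q : Fin (S.d j) → X, dist q ψ < ε ∧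
      (∀ b, (∀ s ∈ A, S.σ j s⁻¹ b ∉ P) → dist (q b) (φ b) ≤ ε) ∧
        ∀ a ∈ P, dist (q a) x₀ ≤ 2 * ε := by
    intro φ hφ P hP
    obtain ⟨B, hB, hgood⟩ := hbad φ hφ
    obtain ⟨q, hq1, hq2, hq3⟩ := hU (S.d j) (S.σ j) (fun a => (φ a : X)) P
      (fun a ha => (Finset.mem_filter.1 (hP ha)).2)
      (fun a ha a' ha' => hVsep a (Finset.mem_filter.1 (hP ha)).1 a'
        (Finset.mem_filter.1 (hP ha')).1)
    have hqmem : q ∈ soficMaps X F' δ' (S.σ j) := by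
      intro t ht
      refine rho2_lt_of_card_le (S.d_pos j) hδ' hC hβC (B ∪ B.image (S.σ j t).symm) ?_ ?_
      · have h1 : ((B ∪ B.image (S.σ j t).symm).card : ℝ) ≤ B.card + B.card := by
          exact_mod_cast (Finset.card_union_le _ _).trans
            (Nat.add_le_add_left Finset.card_image_le _)
        linarith
      · intro b hb
        rw [Finset.notMem_union] at hb
        refine (hE _ _ fun u hu => ?_).le
        refine (hq3 t ht b (hgood b hb.1) (hgood _ fun h => hb.2 ?_) u hu).trans (by linarith)
        exact Finset.mem_image.2 ⟨_, h, Equiv.symm_apply_apply _ _⟩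
    obtain ⟨ψ, hψ, hqψ⟩ := hT q hqmem
    exact ⟨ψ, hψ, q, hqψ, hq1, hq2⟩
  have : Nonempty (Fin (S.d j) → X) := ⟨fun _ => x₀⟩
  choose! f hfT q hqf hq1 hq2 using hex
  -- At `a ∈ P \ Q`, separation keeps the alteration along `Q` away from `a`, so the common net
  -- point would be near both `x₀` and `ψ a ∈ Y`.
  have hsub : ∀ φ ∈ Z, ∀ ψ ∈ Z, ∀ P ⊆ W φ, ∀ Q ⊆ W ψ, f φ P = f ψ Q → P ⊆ Q := by
    intro φ hφ ψ hψ P hP Q hQ hfe a ha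
    by_contra haQ
    have h1 := hq2 φ hφ P hP a ha
    have h2 := hq1 ψ hψ Q hQ a fun s hs h => by
      have := hVsep a (Finset.mem_filter.1 (hP ha)).1 _ (Finset.mem_filter.1 (hQ h)).1 _
        (hAD s hs) rfl
      exact haQ (this ▸ h)
    have h3 := (dist_le_pi_dist _ _ a).trans_lt (hqf φ hφ P hP)
    have h4 := (dist_le_pi_dist _ _ a).trans_lt (hqf ψ hψ Q hQ)
    rw [← hfe] at h4
    have h5 := hY _ (ψ a).2
    have h6 := dist_triangle4 (ψ a : X) (q ψ Q a) (f φ P a) x₀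
    rw [dist_comm (ψ a : X) (q ψ Q a)] at h6
    have h7 := dist_triangle_left (f φ P a) x₀ (q φ P a)
    linarith
  have hfib : ∀ P y, ((Z.filter fun φ => P ⊆ W φ ∧ f φ P = y).card : ℝ) ≤ K ^ P.card := by
    intro P y
    set N := P.biUnion fun a => A.image fun s => (S.σ j s⁻¹).symm a with hN
    have hNcard : N.card ≤ P.card * A.card :=
      Finset.card_biUnion_le_card_mul _ _ _ fun a _ => Finset.card_image_le
    have h1 := card_le_pow_of_label (Z.filter fun φ => P ⊆ W φ ∧ f φ P = y) N
      (fun φ b => l (φ b)) (by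
        intro φ hφ ψ hψ hlab
        rw [Finset.mem_filter] at hφ hψ
        obtain ⟨hφ, hφP, rfl⟩ := hφ
        obtain ⟨hψ, hψP, hfe⟩ := hψ
        by_contra hne
        refine absurd (hsep hφ hψ hne)
          (not_le.2 ((dist_pi_lt_iff (by positivity)).2 fun b => ?_))
        by_cases hb : b ∈ N
        · exact hl _ _ (hlab b hb)
        · have hb' : ∀ s ∈ A, S.σ j s⁻¹ b ∉ P := fun s hs h =>
            hb (Finset.mem_biUnion.2 ⟨_, h, Finset.mem_image.2
              ⟨s, hs, Equiv.symm_apply_apply _ _⟩⟩)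
          have h2 := hq1 φ hφ P hφP b hb'
          have h3 := hq1 ψ hψ P hψP b hb'
          have h4 := (dist_le_pi_dist _ _ b).trans_lt (hqf φ hφ P hφP)
          have h5 := (dist_le_pi_dist _ _ b).trans_lt (hqf ψ hψ P hψP)
          rw [hfe] at h5
          have h6 := dist_triangle4 (φ b : X) (q φ P b) (q ψ P b) (ψ b : X)
          rw [dist_comm (φ b : X) (q φ P b)] at h6
          have h7 := dist_triangle_right (q φ P b) (q ψ P b) (f φ P b)
          rw [Subtype.dist_eq]
          linarith)
    have h2 : K₀ ^ N.card ≤ K₀ ^ (P.card * A.card) := Nat.pow_le_pow_right hK₀ hNcard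
    rw [hKdef, ← pow_mul, mul_comm A.card]
    exact_mod_cast h1.trans h2
  have key := card_mul_pow_le_card Z T W f hK hWcard hfT
    (fun φ hφ ψ hψ P hP Q hQ h => (hsub φ hφ ψ hψ P hP Q hQ h).antisymm
      (hsub ψ hψ φ hφ Q hQ P hP h.symm)) hfib
  have h1K : 1 ≤ 1 + K⁻¹ := by have := inv_pos.2 hK; linarith
  have hgain : Real.exp (κ / 2 * Real.log (1 + K⁻¹) * S.d j) ≤
      (1 + K⁻¹) ^ ⌈κ / 2 * (S.d j : ℝ)⌉₊ := by
    rw [← Real.rpow_natCast, Real.rpow_def_of_pos (by positivity)]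
    refine Real.exp_le_exp.2 ?_
    have := mul_le_mul_of_nonneg_left (Nat.le_ceil (κ / 2 * (S.d j : ℝ))) hlog.le
    linarith
  rw [sub_mul, Real.exp_sub, le_div_iff₀ (Real.exp_pos _)]
  exact (mul_le_mul_of_nonneg_left hgain (Nat.cast_nonneg _)).trans (key.trans hTc)

end Subsystem

end SoficDynamics

/-! ### Conclusion. -/

theorem proposition1p2 {G X : Type*} [Group G] [Countable G]
    [MetricSpace X] [CompactSpace X] [MulAction G X] [ContinuousConstSMul G X]
    (hexp : SoficDynamics.IsExpansive G X)
    (hspec : SoficDynamics.WeakSpecification G X)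
    (hmarkov : SoficDynamics.StrongTopologicalMarkov G X)
    (S : SoficDynamics.SoficApproximation G)
    (hent : 0 ≤ SoficDynamics.soficEntropy S X)
    (Y : SubMulAction G X) (hYclosed : IsClosed (Y : Set X))
    (hYproper : (Y : Set X) ≠ Set.univ) :
    SoficDynamics.soficEntropy S Y < SoficDynamics.soficEntropy S X := by
  obtain ⟨c, hc, hE⟩ := hexp.exists_finset
  obtain ⟨x₀, hx₀⟩ := (Set.ne_univ_iff_exists_notMem _).1 hYproper
  obtain ⟨r, hr, hball⟩ := Metric.isOpen_iff.1 hYclosed.isOpen_compl x₀ hx₀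
  have hY : ∀ y ∈ Y, r ≤ dist y x₀ := fun y hy => by
    by_contra! h
    exact hball h hy
  have : CompactSpace Y := isCompact_iff_compactSpace.1 hYclosed.isCompact
  have hYE : ∀ ε : ℝ, 0 < ε → ∃ E : Finset G,
      ∀ x y : Y, (∀ u ∈ E, dist (u • x) (u • y) ≤ c) → dist x y < ε := fun ε hε => by
    obtain ⟨E, hE⟩ := hE ε hε
    exact ⟨E, fun x y h => hE x y h⟩
  -- Strictness requires a finite entropy of `X`: nonnegativity excludes `⊥` and expansivity
  -- excludes `⊤`.
  have hbot : SoficDynamics.soficEntropy S X ≠ ⊥ := fun h => by simp [h] at hent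
  have htop : SoficDynamics.soficEntropy S X ≠ ⊤ :=
    ((SoficDynamics.soficEntropy_le_scaleEntropy S hc hE).trans_lt
      (SoficDynamics.scaleEntropy_lt_top S (by positivity))).ne
  obtain ⟨η, hη, ε, hε, hgap⟩ :=
    SoficDynamics.exists_scaleEntropy_gap hspec hmarkov S hc hE Y x₀ hr hY
  obtain ⟨h, hh⟩ : ∃ h : ℝ, SoficDynamics.soficEntropy S X = (h : EReal) :=
    ⟨_, (EReal.coe_toReal htop hbot).symm⟩
  have h1 : SoficDynamics.scaleEntropy S X ε < ((h + η / 2 : ℝ) : EReal) := by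
    refine (SoficDynamics.scaleEntropy_le_soficEntropy S hε).trans_lt ?_
    rw [hh, EReal.coe_lt_coe_iff]
    linarith
  refine ((SoficDynamics.soficEntropy_le_scaleEntropy S hc hYE).trans (hgap _ h1)).trans_lt ?_
  rw [hh, EReal.coe_lt_coe_iff]
  linarith
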